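/- Let $n$ be a natural number and let $B_n\subset\mathbb R^{n\times n}$ be the polytope of doubly stochastic $n\times n$ matrices. Faces are understood to be nonempty, and a facet of a polytope is a maximal proper face. For a $d$-dimensional face $F$ of $B_n$, let $L$ be the affine lattice of integer points in the affine span of $F$; the relative volume of $F$ is the Euclidean $d$-dimensional volume of $F$ divided by the minimum $d$-dimensional volume of a (nondegenerate) $d$-simplex with vertices in $L$. A standard triangulation of a polytope $P$ is a set of simplices obtained recursively: if $P$ is a single point, it is $\{P\}$; otherwise choose an arbitrary vertex $v$ of $P$, choose a standard triangulation of each facet of $P$ opposite $v$ (that is, not containing $v$), and add the vertex $v$ to each simplex of these triangulations. Let $F$ be a face of $B_n$. Then: 1. Every standard triangulation of $F$ is finite, and the number of its simplices is equal to the relative volume of $F$. 2. If $\dim F\ge 1$, then for every vertex $v$ of $F$ the relative volume of $F$ is equal to the sum of the relative volumes of the facets of $F$ opposite $v$. -/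

import Mathlib

namespace Birkhoff

/-- The polytope `B_n` of doubly stochastic `n × n` matrices, as a subset of `n²`-dimensional
Euclidean space (the coordinates are the matrix entries). -/
def birkhoff (n : ℕ) : Set (EuclideanSpace ℝ (Fin n × Fin n)) :=
  {x | Matrix.of (fun i j => x (i, j)) ∈ doublyStochastic ℝ (Fin n)}

section Faces

variable {E : Type*} [NormedAddCommGroup E] [NormedSpace ℝ E]

/-- `F` is a (nonempty) face of `P`: the set of points of `P` at which some linear functional
attains its maximum over `P`. The polytope `P` itself is a face of `P`. -/
def IsFace (P F : Set E) : Prop :=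
  F.Nonempty ∧ IsExposed ℝ P F

/-- A facet of `P` is a maximal proper face of `P`. -/
def IsFacet (P G : Set E) : Prop :=
  Maximal (fun H => IsFace P H ∧ H ≠ P) G

/-- `G` is a facet of `P` opposite `v`, that is, a facet which does not contain `v`. -/
def IsFacetOpposite (P : Set E) (v : E) (G : Set E) : Prop :=
  IsFacet P G ∧ v ∉ G

/-- `IsStandardTriangulation P T` : `T` is a standard triangulation of the polytope `P`, each
simplex of `T` (only those of full dimension are listed) being given by its set of vertices.
A one-point polytope is triangulated by itself. If `P` has more than one point, choose an arbitrary
vertex `v` of `P`, choose a standard triangulation `S G` of every facet `G` opposite `v`, and add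
the vertex `v` to each of the simplices of these triangulations. -/
inductive IsStandardTriangulation : Set E → Set (Set E) → Prop
  | point (v : E) : IsStandardTriangulation {v} {{v}}
  | cone (P : Set E) (hP : P.Nontrivial) (v : E) (hv : v ∈ P.extremePoints ℝ)
      (S : Set E → Set (Set E))
      (hS : ∀ G, IsFacetOpposite P v G → IsStandardTriangulation G (S G)) :
      IsStandardTriangulation P {s | ∃ G, IsFacetOpposite P v G ∧ ∃ t ∈ S G, s = insert v t}

end Faces

section Volume

variable {ι : Type*} [Fintype ι]

/-- The dimension of (the affine span of) `F`. -/
noncomputable def dim (F : Set (EuclideanSpace ℝ ι)) : ℕ :=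
  Module.finrank ℝ (vectorSpan ℝ F)

/-- The affine lattice of integer points in the affine span of `F`. -/
def latticePoints (F : Set (EuclideanSpace ℝ ι)) : Set (EuclideanSpace ℝ ι) :=
  {x | x ∈ affineSpan ℝ F ∧ ∀ p, ∃ k : ℤ, x p = k}

/-- The minimum Euclidean `d`-volume of a `d`-simplex with vertices in the affine lattice
determined by `F`, where `d` is the dimension of `F`. -/
noncomputable def minSimplexVolume (F : Set (EuclideanSpace ℝ ι)) : ENNReal :=
  sInf {V | ∃ w : Fin (dim F + 1) → EuclideanSpace ℝ ι,
    (∀ i, w i ∈ latticePoints F) ∧ AffineIndependent ℝ w ∧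
    V = MeasureTheory.Measure.euclideanHausdorffMeasure (dim F) (convexHull ℝ (Set.range w))}

/-- The relative volume of `F`: its Euclidean `d`-volume, `d` the dimension of `F`, in units equal
to the volume of a minimal simplex in the affine lattice determined by `F`. -/
noncomputable def relativeVolume (F : Set (EuclideanSpace ℝ ι)) : ENNReal :=
  MeasureTheory.Measure.euclideanHausdorffMeasure (dim F) F / minSimplexVolume F

end Volume

end Birkhoff

/-!
A face `F` of the Birkhoff polytope is the intersection of its affine span with the nonnegative
orthant, and its vertices are zero-one vectors (permutation matrices). Both properties, recorded in
`IsZeroOneSlice`, pass to faces. Choosing an irredundant subsystem `B` of the inequalities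
`0 ≤ x p`, the facets of `F` are exactly the sets `{x ∈ F | x p = 0}` with `p ∈ B`
(`IsIrredundant.isFacet_iff`), and each of them has codimension one
(`IsIrredundant.mem_affineSpan_facet`). If such a facet does not contain the vertex `v`, then
`v p = 1`: the vertex `v` has lattice height one over every opposite facet. This is what makes the
argument work.

First, every simplex of a standard triangulation is unimodular, that is, its vertices generate the
affine lattice of `F`: an integer point of the affine span of `F` is moved into the facet by
subtracting an integer multiple of `v - w`, where `w` is a vertex of the simplex in the facet
(`IsUnimodularSimplex.insert_vertex`). Secondly, the simplices tile `F`: the cones over the opposite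
facets cover `F` since a ray from `v` leaves `F` through an opposite facet
(`IsZeroOneSlice.exists_facetOpposite`), and comparing the two height coordinates of a common
interior point of two cones shows that they have the same base
(`IsUnimodularSimplex.facet_eq_of_mem_openHull`).

A unimodular simplex has minimal volume among the lattice simplices, because the volume of any other
is a nonzero integer multiple of it (`measure_simplex_le`). Hence the volume of `F` is the number of
simplices times the minimal volume, which is the first assertion
(`IsUnimodularTriangulation.ncard_eq_relativeVolume`). The second one follows by counting the
simplices of a cone triangulation facet by facet (`ncard_cone`).
-/

namespace Birkhoff

open Set MeasureTheory

/-! ### Polytopes cut out of the orthant and their facets -/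

section Slices

variable {ι : Type*}

/-- A polytope cut out of the nonnegative orthant by its own affine span, all of whose vertices have
coordinates in `{0, 1}`. Every face of the Birkhoff polytope has this form, and the property
passes to facets. -/
structure IsZeroOneSlice (F : Set (EuclideanSpace ℝ ι)) : Prop where
  nonempty : F.Nonempty
  isCompact : IsCompact F
  mem_iff : ∀ x, x ∈ F ↔ x ∈ affineSpan ℝ F ∧ ∀ p, 0 ≤ x p
  extremePoint : ∀ v ∈ F.extremePoints ℝ, ∀ p, v p = 0 ∨ v p = 1

/-- The polytope `F` is cut out of its affine span by the inequalities `0 ≤ x p` with `p ∈ B`, and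
each of these inequalities is needed: dropping it admits a new point. -/
structure IsIrredundant (F : Set (EuclideanSpace ℝ ι)) (B : Finset ι) : Prop where
  mem_iff : ∀ x, x ∈ F ↔ x ∈ affineSpan ℝ F ∧ ∀ p ∈ B, 0 ≤ x p
  exists_neg : ∀ p ∈ B, ∃ u ∈ affineSpan ℝ F, u p < 0 ∧ ∀ q ∈ B, q ≠ p → 0 ≤ u q

lemma add_smul_sub_mem_span {F : Set (EuclideanSpace ℝ ι)} {x y z : EuclideanSpace ℝ ι}
    (hx : x ∈ affineSpan ℝ F) (hy : y ∈ affineSpan ℝ F) (hz : z ∈ affineSpan ℝ F) (t : ℝ) :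
    x + t • (y - z) ∈ affineSpan ℝ F := by
  have := (affineSpan ℝ F).smul_vsub_vadd_mem t hy hz hx
  rwa [vsub_eq_sub, vadd_eq_add, add_comm] at this

lemma coord_eq_zero_of_mem_affineSpan {S : Set (EuclideanSpace ℝ ι)} {p : ι}
    (h : ∀ y ∈ S, y p = 0) {x : EuclideanSpace ℝ ι} (hx : x ∈ affineSpan ℝ S) : x p = 0 := by
  have hle : affineSpan ℝ S ≤
      AffineSubspace.mk' (0 : EuclideanSpace ℝ ι) (EuclideanSpace.proj (𝕜 := ℝ) p).ker := by
    rw [affineSpan_le]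
    intro y hy
    simpa [AffineSubspace.mem_mk'] using h y hy
  simpa [AffineSubspace.mem_mk'] using hle hx

lemma convex_of_mem_iff {F : Set (EuclideanSpace ℝ ι)} {B : Finset ι} {A : AffineSubspace ℝ _}
    (hB : ∀ x, x ∈ F ↔ x ∈ A ∧ ∀ p ∈ B, 0 ≤ x p) : Convex ℝ F := by
  intro x hx y hy a b ha hb hab
  rw [hB] at *
  refine ⟨A.convex hx.1 hy.1 ha hb hab, fun p hp => ?_⟩
  simpa using add_nonneg (mul_nonneg ha (hx.2 p hp)) (mul_nonneg hb (hy.2 p hp))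

lemma exists_pos_add_mul_nonneg {B : Finset ι} {w d : ι → ℝ}
    (h : ∀ q ∈ B, 0 < w q ∨ (w q = 0 ∧ 0 ≤ d q)) :
    ∃ ε > 0, ∀ q ∈ B, 0 ≤ w q + ε * d q := by
  have h1 : ∀ᶠ ε in nhdsWithin (0 : ℝ) (Ioi 0), ∀ q ∈ B, 0 ≤ w q + ε * d q := by
    rw [Filter.eventually_all_finset]
    intro q hq
    rcases h q hq with h0 | ⟨h0, h0'⟩
    · have : Filter.Tendsto (fun ε : ℝ => w q + ε * d q) (nhdsWithin 0 (Ioi 0))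
          (nhds (w q + 0 * d q)) :=
        (Continuous.tendsto (by fun_prop) 0).mono_left nhdsWithin_le_nhds
      filter_upwards [this.eventually_const_lt (u := 0) (by simpa using h0)] with ε hε using hε.le
    · filter_upwards [self_mem_nhdsWithin] with ε hε
      rw [h0, zero_add]
      exact mul_nonneg (le_of_lt hε) h0'
  obtain ⟨ε, hε, hε'⟩ := (h1.and self_mem_nhdsWithin).exists
  exact ⟨ε, hε', hε⟩

lemma exists_forall_pos {H : Set (EuclideanSpace ℝ ι)} (hc : Convex ℝ H) (hne : H.Nonempty)
    (B : Finset ι) (h0 : ∀ x ∈ H, ∀ p ∈ B, 0 ≤ x p) :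
    ∃ h ∈ H, ∀ p ∈ B, (∃ x ∈ H, 0 < x p) → 0 < h p := by
  classical
  induction B using Finset.induction_on with
  | empty => obtain ⟨h, hh⟩ := hne; exact ⟨h, hh, by simp⟩
  | insert a B ha ih =>
    obtain ⟨h, hh, hp⟩ := ih fun x hx p hp => h0 x hx p (Finset.mem_insert_of_mem hp)
    by_cases hex : ∃ x ∈ H, 0 < x a
    · obtain ⟨x, hx, hxa⟩ := hex
      refine ⟨(1 / 2 : ℝ) • h + (1 / 2 : ℝ) • x,
        hc hh hx (by norm_num) (by norm_num) (by norm_num), fun p hpB hex => ?_⟩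
      simp only [PiLp.add_apply, PiLp.smul_apply, smul_eq_mul]
      have hhp := h0 h hh p hpB
      have hxp := h0 x hx p hpB
      rcases Finset.mem_insert.1 hpB with rfl | hpB
      · linarith
      · linarith [hp p hpB hex]
    · refine ⟨h, hh, fun p hpB hex' => ?_⟩
      rcases Finset.mem_insert.1 hpB with rfl | hpB
      · exact absurd hex' hex
      · exact hp p hpB hex'

namespace IsZeroOneSlice

variable {F : Set (EuclideanSpace ℝ ι)}

lemma convex [Fintype ι] (hF : IsZeroOneSlice F) : Convex ℝ F :=
  convex_of_mem_iff (B := Finset.univ) (by simpa using hF.mem_iff)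

lemma exists_isIrredundant [Fintype ι] (hF : IsZeroOneSlice F) : ∃ B, IsIrredundant F B := by
  classical
  have hex : ∃ B : Finset ι, ∀ x, x ∈ F ↔ x ∈ affineSpan ℝ F ∧ ∀ p ∈ B, 0 ≤ x p :=
    ⟨Finset.univ, by simpa using hF.mem_iff⟩
  obtain ⟨B, hB⟩ := exists_minimal_of_wellFoundedLT _ hex
  refine ⟨B, hB.prop, fun p hp => ?_⟩
  by_contra! hcon
  have h : ∀ x, x ∈ F ↔ x ∈ affineSpan ℝ F ∧ ∀ q ∈ B.erase p, 0 ≤ x q := by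
    intro x
    rw [hB.prop]
    refine and_congr_right fun hx => ⟨fun h q hq => h q (Finset.mem_of_mem_erase hq),
      fun h q hq => ?_⟩
    by_cases hqp : q = p
    · subst hqp
      by_contra! hneg
      obtain ⟨r, hr, hrq, hlt⟩ := hcon x hx hneg
      exact absurd (h r (Finset.mem_erase.2 ⟨hrq, hr⟩)) (not_le.2 hlt)
    · exact h q (Finset.mem_erase.2 ⟨hqp, hq⟩)
  exact Finset.notMem_erase p B (hB.le_of_le h (Finset.erase_subset p B) hp)

end IsZeroOneSlice

namespace IsIrredundant

variable [Fintype ι] {F : Set (EuclideanSpace ℝ ι)} {B : Finset ι}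

lemma exists_pos_point (hB : IsIrredundant F B) (hF : IsZeroOneSlice F) :
    ∃ c ∈ F, ∀ p ∈ B, 0 < c p := by
  obtain ⟨c, hc, hpos⟩ := exists_forall_pos hF.convex hF.nonempty B
    fun x hx p hp => ((hB.mem_iff x).1 hx).2 p hp
  refine ⟨c, hc, fun p hp => hpos p hp ?_⟩
  by_contra! hcon
  obtain ⟨u, hu, hneg, -⟩ := hB.exists_neg p hp
  have := coord_eq_zero_of_mem_affineSpan
    (fun x hx => le_antisymm (hcon x hx) (((hB.mem_iff x).1 hx).2 p hp)) hu
  linarith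

/-- The facet defined by `p` has a point at which no other inequality of the irredundant system
is tight. -/
lemma exists_facet_interior_point (hB : IsIrredundant F B) (hF : IsZeroOneSlice F) {p : ι}
    (hp : p ∈ B) : ∃ w ∈ F, w p = 0 ∧ ∀ q ∈ B, q ≠ p → 0 < w q := by
  obtain ⟨c, hc, hcpos⟩ := hB.exists_pos_point hF
  obtain ⟨u, hu, hup, huq⟩ := hB.exists_neg p hp
  have hcp := hcpos p hp
  have hd : 0 < c p - u p := by linarith
  have hcA := ((hB.mem_iff c).1 hc).1
  have hval : ∀ q, (c + (c p / (c p - u p)) • (u - c)) q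
      = (c p * u q + (- u p) * c q) / (c p - u p) := by
    intro q
    simp
    field_simp
    ring
  have h0 : (c + (c p / (c p - u p)) • (u - c)) p = 0 := by
    rw [hval]; ring
  have hpos : ∀ q ∈ B, q ≠ p → 0 < (c + (c p / (c p - u p)) • (u - c)) q := by
    intro q hq hqp
    rw [hval]
    have h1 := mul_nonneg hcp.le (huq q hq hqp)
    have h2 := mul_pos (neg_pos.2 hup) (hcpos q hq)
    exact div_pos (by linarith) hd
  refine ⟨_, (hB.mem_iff _).2 ⟨add_smul_sub_mem_span hcA hu hcA _, fun q hq => ?_⟩, h0, hpos⟩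
  by_cases hqp : q = p
  · rw [hqp, h0]
  · exact (hpos q hq hqp).le

/-- The facet defined by an irredundant inequality has codimension one. -/
lemma mem_affineSpan_facet (hB : IsIrredundant F B) (hF : IsZeroOneSlice F) {p : ι}
    (hp : p ∈ B) {x : EuclideanSpace ℝ ι} (hx : x ∈ affineSpan ℝ F) (hxp : x p = 0) :
    x ∈ affineSpan ℝ {y ∈ F | y p = 0} := by
  obtain ⟨w, hw, hwp, hpos⟩ := hB.exists_facet_interior_point hF hp
  obtain ⟨ε, hε, h⟩ := exists_pos_add_mul_nonneg (B := B) (w := w) (d := fun q => x q - w q) (by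
    intro q hq
    by_cases hqp : q = p
    · right; rw [hqp, hwp, hxp]; simp
    · exact Or.inl (hpos q hq hqp))
  have hwA := ((hB.mem_iff w).1 hw).1
  have hmem : w + ε • (x - w) ∈ {y ∈ F | y p = 0} := by
    refine ⟨(hB.mem_iff _).2 ⟨add_smul_sub_mem_span hwA hx hwA _, fun q hq => ?_⟩, ?_⟩
    · simpa using h q hq
    · simp [hwp, hxp]
  have hw' : w ∈ {y ∈ F | y p = 0} := ⟨hw, hwp⟩
  have := add_smul_sub_mem_span (subset_affineSpan ℝ _ hw') (subset_affineSpan ℝ _ hmem)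
    (subset_affineSpan ℝ _ hw') ε⁻¹
  simpa [smul_smul, hε.ne'] using this

end IsIrredundant

/-- A face of a polytope is determined by the defining inequalities that are tight on it. -/
lemma IsFace.exists_tight [Fintype ι] {F H : Set (EuclideanSpace ℝ ι)} {B : Finset ι} {A : AffineSubspace ℝ _}
    (hB : ∀ x, x ∈ F ↔ x ∈ A ∧ ∀ p ∈ B, 0 ≤ x p) (hH : IsFace F H) :
    ∃ Z ⊆ B, H = {x ∈ F | ∀ p ∈ Z, x p = 0} := by
  classical
  have hcF : Convex ℝ F := convex_of_mem_iff hB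
  have hsub := hH.2.subset
  obtain ⟨h, hh, hpos⟩ := exists_forall_pos (hH.2.convex hcF) hH.1 B
    fun x hx p hp => ((hB x).1 (hsub hx)).2 p hp
  refine ⟨B.filter fun p => h p = 0, Finset.filter_subset _ _, ?_⟩
  obtain ⟨l, hl⟩ := hH.2 hH.1
  ext x
  refine ⟨fun hx => ⟨hsub hx, fun p hp => ?_⟩, fun ⟨hx, hZ⟩ => ?_⟩
  · obtain ⟨hpB, hp⟩ := Finset.mem_filter.1 hp
    by_contra hne
    have := hpos p hpB ⟨x, hx, lt_of_le_of_ne (((hB x).1 (hsub hx)).2 p hpB) (Ne.symm hne)⟩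
    linarith
  · have hhF := (hB h).1 (hsub hh)
    have hxF := (hB x).1 hx
    -- From `h`, a point of `H` interior to `H`, one can move slightly away from `x` inside `F`.
    obtain ⟨ε, hε, he⟩ := exists_pos_add_mul_nonneg (B := B) (w := h) (d := fun q => h q - x q) (by
      intro q hq
      by_cases hq0 : h q = 0
      · exact Or.inr ⟨hq0, by rw [hq0, hZ q (Finset.mem_filter.2 ⟨hq, hq0⟩)]; simp⟩
      · exact Or.inl (lt_of_le_of_ne (hhF.2 q hq) (Ne.symm hq0)))
    have hmem : h + ε • (h - x) ∈ F := by
      refine (hB _).2 ⟨?_, fun q hq => by simpa using he q hq⟩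
      have := A.smul_vsub_vadd_mem ε hhF.1 hxF.1 hhF.1
      rwa [vsub_eq_sub, vadd_eq_add, add_comm] at this
    rw [hl] at hh ⊢
    have h1 := hh.2 _ hmem
    simp only [map_add, map_smul, map_sub, smul_eq_mul] at h1
    have h2 : l h ≤ l x := by nlinarith
    exact ⟨hx, fun y hy => (hh.2 y hy).trans h2⟩

namespace IsIrredundant

variable [Fintype ι] {F : Set (EuclideanSpace ℝ ι)} {B : Finset ι}

lemma isFace_coord (hB : IsIrredundant F B) (hF : IsZeroOneSlice F) {p : ι} (hp : p ∈ B) :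
    IsFace F {x ∈ F | x p = 0} := by
  obtain ⟨w, hw, hwp, -⟩ := hB.exists_facet_interior_point hF hp
  refine ⟨⟨w, hw, hwp⟩, fun _ => ⟨-EuclideanSpace.proj p, ?_⟩⟩
  ext x
  constructor
  · rintro ⟨hx, hxp⟩
    refine ⟨hx, fun y hy => ?_⟩
    have := ((hB.mem_iff y).1 hy).2 p hp
    simpa [hxp] using this
  · rintro ⟨hx, hxp⟩
    refine ⟨hx, le_antisymm ?_ (((hB.mem_iff x).1 hx).2 p hp)⟩
    have := hxp w hw
    simpa [hwp] using this

lemma coord_face_ne (hB : IsIrredundant F B) (hF : IsZeroOneSlice F) {p : ι} (hp : p ∈ B) :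
    {x ∈ F | x p = 0} ≠ F := by
  intro h
  obtain ⟨c, hc, hpos⟩ := hB.exists_pos_point hF
  rw [← h] at hc
  exact (hpos p hp).ne' hc.2

lemma exists_coord_face (hB : IsIrredundant F B) {H : Set (EuclideanSpace ℝ ι)}
    (hH : IsFace F H) (hne : H ≠ F) : ∃ p ∈ B, H ⊆ {x ∈ F | x p = 0} := by
  obtain ⟨Z, hZ, rfl⟩ := hH.exists_tight hB.mem_iff
  rcases Z.eq_empty_or_nonempty with rfl | ⟨p, hp⟩
  · simp at hne
  · exact ⟨p, hZ hp, fun x hx => ⟨hx.1, hx.2 p hp⟩⟩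

/-- The facets of `F` are in bijection with the inequalities of an irredundant system. -/
lemma isFacet_iff (hB : IsIrredundant F B) (hF : IsZeroOneSlice F)
    {G : Set (EuclideanSpace ℝ ι)} : IsFacet F G ↔ ∃ p ∈ B, G = {x ∈ F | x p = 0} := by
  constructor
  · intro hG
    obtain ⟨p, hp, hsub⟩ := hB.exists_coord_face hG.prop.1 hG.prop.2
    exact ⟨p, hp, hG.eq_of_le ⟨hB.isFace_coord hF hp, hB.coord_face_ne hF hp⟩ hsub⟩
  · rintro ⟨p, hp, rfl⟩
    refine ⟨⟨hB.isFace_coord hF hp, hB.coord_face_ne hF hp⟩, fun H hH hle => ?_⟩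
    obtain ⟨q, hq, hsub⟩ := hB.exists_coord_face hH.1 hH.2
    obtain ⟨w, hw, hwp, hpos⟩ := hB.exists_facet_interior_point hF hp
    have hwq : w q = 0 := (hsub (hle ⟨hw, hwp⟩)).2
    have hqp : q = p := by
      by_contra hne
      exact (hpos q hq hne).ne' hwq
    rwa [hqp] at hsub

end IsIrredundant

/-- A face of a compact slice of the nonnegative orthant with zero-one vertices is a zero-one slice.
The slicing subspace `A` may be larger than the affine span of `F`. -/
lemma IsFace.isZeroOneSlice [Fintype ι] {F H : Set (EuclideanSpace ℝ ι)} {A : AffineSubspace ℝ _}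
    (hcomp : IsCompact F) (hA : ∀ x, x ∈ F ↔ x ∈ A ∧ ∀ p, 0 ≤ x p)
    (hext : ∀ v ∈ F.extremePoints ℝ, ∀ p, v p = 0 ∨ v p = 1) (hH : IsFace F H) :
    IsZeroOneSlice H := by
  have hA' : ∀ x, x ∈ F ↔ x ∈ A ∧ ∀ p ∈ Finset.univ, 0 ≤ x p := by simpa using hA
  refine ⟨hH.1, hH.2.isCompact hcomp, fun x => ⟨fun hx => ⟨subset_affineSpan ℝ _ hx,
    ((hA x).1 (hH.2.subset hx)).2⟩, fun ⟨hx, h0⟩ => ?_⟩,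
    fun v hv => hext v (hH.2.isExtreme.extremePoints_subset_extremePoints hv)⟩
  obtain ⟨Z, -, rfl⟩ := hH.exists_tight hA'
  have hxA : x ∈ A :=
    affineSpan_le.2 (fun y (hy : y ∈ {x ∈ F | ∀ p ∈ Z, x p = 0}) => ((hA y).1 hy.1).1) hx
  refine ⟨(hA x).2 ⟨hxA, h0⟩, fun p hp => ?_⟩
  exact coord_eq_zero_of_mem_affineSpan (fun y hy => hy.2 p hp) hx

lemma IsZeroOneSlice.of_isFace [Fintype ι] {F H : Set (EuclideanSpace ℝ ι)} (hF : IsZeroOneSlice F)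
    (hH : IsFace F H) : IsZeroOneSlice H :=
  hH.isZeroOneSlice hF.isCompact hF.mem_iff hF.extremePoint

end Slices

/-! ### Faces of the Birkhoff polytope -/

section BirkhoffFaces

variable (n : ℕ)

/-- Matrices as points of Euclidean space. -/
def matrixEquiv : Matrix (Fin n) (Fin n) ℝ ≃ₗ[ℝ] EuclideanSpace ℝ (Fin n × Fin n) :=
  (LinearEquiv.curry ℝ ℝ (Fin n) (Fin n)).symm.trans
    (WithLp.linearEquiv 2 ℝ (Fin n × Fin n → ℝ)).symm

lemma matrixEquiv_apply (M : Matrix (Fin n) (Fin n) ℝ) (p : Fin n × Fin n) :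
    matrixEquiv n M p = M p.1 p.2 := rfl

lemma birkhoff_eq_image :
    birkhoff n = matrixEquiv n '' (doublyStochastic ℝ (Fin n) : Set (Matrix (Fin n) (Fin n) ℝ)) := by
  ext x
  constructor
  · intro hx
    exact ⟨_, hx, rfl⟩
  · rintro ⟨M, hM, rfl⟩
    exact hM

lemma isCompact_birkhoff : IsCompact (birkhoff n) := by
  rw [birkhoff_eq_image, doublyStochastic_eq_convexHull_permMatrix]
  exact (Set.Finite.isCompact_convexHull (𝕜 := ℝ)
    (Set.finite_range fun σ : Equiv.Perm (Fin n) => σ.permMatrix ℝ)).image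
    (LinearMap.continuous_of_finiteDimensional (matrixEquiv n).toLinearMap)

lemma extremePoints_birkhoff {v : EuclideanSpace ℝ (Fin n × Fin n)}
    (hv : v ∈ (birkhoff n).extremePoints ℝ) (p : Fin n × Fin n) : v p = 0 ∨ v p = 1 := by
  rw [birkhoff_eq_image, ← image_extremePoints (𝕜 := ℝ) (matrixEquiv n), extremePoints_doublyStochastic] at hv
  obtain ⟨_, ⟨σ, rfl⟩, rfl⟩ := hv
  rw [matrixEquiv_apply, Equiv.Perm.permMatrix, PEquiv.toMatrix_apply]
  split_ifs <;> simp

/-- The affine space of matrices with all row and column sums equal to one. -/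
def stochasticAffine : AffineSubspace ℝ (EuclideanSpace ℝ (Fin n × Fin n)) where
  carrier := {x | (∀ i, ∑ j, x (i, j) = 1) ∧ ∀ j, ∑ i, x (i, j) = 1}
  smul_vsub_vadd_mem' := by
    rintro c x y z ⟨hx, hx'⟩ ⟨hy, hy'⟩ ⟨hz, hz'⟩
    constructor <;> intro i <;>
      simp [Finset.sum_add_distrib, ← Finset.mul_sum, Finset.sum_sub_distrib, *]

lemma mem_birkhoff_iff (x : EuclideanSpace ℝ (Fin n × Fin n)) :
    x ∈ birkhoff n ↔ x ∈ stochasticAffine n ∧ ∀ p, 0 ≤ x p := by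
  change Matrix.of (fun i j => x (i, j)) ∈ doublyStochastic ℝ (Fin n) ↔
    ((∀ i, ∑ j, x (i, j) = 1) ∧ ∀ j, ∑ i, x (i, j) = 1) ∧ _
  rw [mem_doublyStochastic_iff_sum]
  simp only [Matrix.of_apply, Prod.forall]
  tauto

lemma isZeroOneSlice_of_isFace_birkhoff {F : Set (EuclideanSpace ℝ (Fin n × Fin n))}
    (hF : IsFace (birkhoff n) F) : IsZeroOneSlice F :=
  hF.isZeroOneSlice (isCompact_birkhoff n) (mem_birkhoff_iff n)
    fun _ hv => extremePoints_birkhoff n hv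

end BirkhoffFaces

/-! ### Unimodular triangulations -/

section Triangulations

lemma eq_of_insert_eq_insert {α : Type*} {v : α} {s t : Set α} (hs : v ∉ s) (ht : v ∉ t)
    (h : insert v s = insert v t) : s = t := by
  rw [← insert_sdiff_self_of_notMem hs, h, insert_sdiff_self_of_notMem ht]

variable {ι : Type*}

/-- The relatively open simplex with vertex set `s`: the points with positive barycentric
coordinates. -/
def openHull (s : Finset (EuclideanSpace ℝ ι)) : Set (EuclideanSpace ℝ ι) :=
  {x | ∃ a : EuclideanSpace ℝ ι → ℝ, (∀ y ∈ s, 0 < a y) ∧ ∑ y ∈ s, a y = 1 ∧ ∑ y ∈ s, a y • y = x}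

lemma openHull_subset_convexHull (s : Finset (EuclideanSpace ℝ ι)) :
    openHull s ⊆ convexHull ℝ (s : Set (EuclideanSpace ℝ ι)) := by
  rintro x ⟨a, ha, h1, rfl⟩
  exact Finset.mem_convexHull'.2 ⟨a, fun y hy => (ha y hy).le, h1, rfl⟩

lemma coord_sum {s : Finset (EuclideanSpace ℝ ι)} (a : EuclideanSpace ℝ ι → ℝ) (p : ι) :
    (∑ y ∈ s, a y • y) p = ∑ y ∈ s, a y * y p := by
  simp

/-- A coordinate that is nonnegative on the vertices of a simplex and vanishes at an interior
point vanishes at all vertices. -/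
lemma coord_eq_zero_of_mem_openHull {s : Finset (EuclideanSpace ℝ ι)} {p : ι}
    (h0 : ∀ y ∈ s, 0 ≤ y p) {x : EuclideanSpace ℝ ι} (hx : x ∈ openHull s) (hxp : x p = 0) :
    ∀ y ∈ s, y p = 0 := by
  obtain ⟨a, ha, -, rfl⟩ := hx
  rw [coord_sum, Finset.sum_eq_zero_iff_of_nonneg
    fun y hy => mul_nonneg (ha y hy).le (h0 y hy)] at hxp
  intro y hy
  exact (mul_eq_zero.1 (hxp y hy)).resolve_left (ha y hy).ne'

lemma exists_of_mem_openHull_insert [DecidableEq (EuclideanSpace ℝ ι)]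
    {s : Finset (EuclideanSpace ℝ ι)} (hs : s.Nonempty)
    {v : EuclideanSpace ℝ ι} (hv : v ∉ s) {x : EuclideanSpace ℝ ι}
    (hx : x ∈ openHull (insert v s)) :
    ∃ y ∈ openHull s, ∃ c : ℝ, 0 < c ∧ x = (1 - c) • v + c • y := by
  obtain ⟨a, ha, h1, rfl⟩ := hx
  rw [Finset.sum_insert hv] at h1
  have hc : 0 < ∑ y ∈ s, a y :=
    Finset.sum_pos (fun y hy => ha y (Finset.mem_insert_of_mem hy)) hs
  refine ⟨_, ⟨fun y => a y / ∑ y ∈ s, a y,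
    fun y hy => div_pos (ha y (Finset.mem_insert_of_mem hy)) hc, ?_, rfl⟩, ∑ y ∈ s, a y, hc, ?_⟩
  · rw [← Finset.sum_div, div_self hc.ne']
  · rw [Finset.sum_insert hv, Finset.smul_sum, ← h1, add_sub_cancel_right]
    congr 1
    refine Finset.sum_congr rfl fun y _ => ?_
    rw [smul_smul, mul_div_cancel₀ _ hc.ne']

variable [Fintype ι]

/-- `s` is the vertex set of a unimodular simplex of `F`: an affinely independent set of integer
points of `F` which generates the affine lattice of `F` by integer affine combinations. -/
structure IsUnimodularSimplex (F : Set (EuclideanSpace ℝ ι)) (s : Finset (EuclideanSpace ℝ ι)) :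
    Prop where
  subset : (s : Set (EuclideanSpace ℝ ι)) ⊆ F
  integral : ∀ y ∈ s, ∀ p, ∃ k : ℤ, y p = k
  affineIndependent : AffineIndependent ℝ ((↑) : s → EuclideanSpace ℝ ι)
  span_eq : affineSpan ℝ (s : Set (EuclideanSpace ℝ ι)) = affineSpan ℝ F
  exists_int_comb : ∀ z ∈ latticePoints F, ∃ k : EuclideanSpace ℝ ι → ℤ,
    ∑ y ∈ s, k y = 1 ∧ ∑ y ∈ s, (k y : ℝ) • y = z

/-- A triangulation of `F` into unimodular simplices, in the sense needed to compute volumes: the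
simplices cover `F`, and their relative interiors are pairwise disjoint. -/
structure IsUnimodularTriangulation (F : Set (EuclideanSpace ℝ ι))
    (T : Set (Set (EuclideanSpace ℝ ι))) : Prop where
  finite : T.Finite
  exists_simplex : ∀ s ∈ T, ∃ t : Finset (EuclideanSpace ℝ ι), s = t ∧ IsUnimodularSimplex F t
  cover : ∀ x ∈ F, ∃ s ∈ T, x ∈ convexHull ℝ s
  eq_of_mem_openHull : ∀ s t : Finset (EuclideanSpace ℝ ι), (s : Set (EuclideanSpace ℝ ι)) ∈ T →
    (t : Set (EuclideanSpace ℝ ι)) ∈ T → ∀ x, x ∈ openHull s → x ∈ openHull t → s = t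

lemma isUnimodularTriangulation_singleton {v : EuclideanSpace ℝ ι}
    (hv : ∀ p, ∃ k : ℤ, v p = k) : IsUnimodularTriangulation {v} {{v}} where
  finite := finite_singleton _
  exists_simplex := by
    rintro s rfl
    refine ⟨{v}, by simp, ⟨by simp, by simpa using hv, ?_, by simp, ?_⟩⟩
    · have : Subsingleton (({v} : Finset (EuclideanSpace ℝ ι))) :=
        ⟨fun a b => Subtype.ext ((Finset.mem_singleton.1 a.2).trans
          (Finset.mem_singleton.1 b.2).symm)⟩
      exact affineIndependent_of_subsingleton ℝ _
    · rintro z ⟨hz, -⟩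
      refine ⟨fun _ => 1, by simp, ?_⟩
      simpa using ((AffineSubspace.mem_affineSpan_singleton ℝ _).1 hz).symm
  cover := by
    rintro x rfl
    exact ⟨{x}, rfl, by simp⟩
  eq_of_mem_openHull := by
    intro s t hs ht _ _ _
    exact Finset.coe_injective ((mem_singleton_iff.1 hs).trans (mem_singleton_iff.1 ht).symm)

variable {F G : Set (EuclideanSpace ℝ ι)} {v : EuclideanSpace ℝ ι}

/-- A vertex `v` has lattice height one over each facet opposite `v`. -/
lemma IsIrredundant.isFacetOpposite_iff {B : Finset ι} (hB : IsIrredundant F B)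
    (hF : IsZeroOneSlice F) (hv : v ∈ F.extremePoints ℝ) :
    IsFacetOpposite F v G ↔ ∃ p ∈ B, v p = 1 ∧ G = {x ∈ F | x p = 0} := by
  rw [IsFacetOpposite, hB.isFacet_iff hF]
  constructor
  · rintro ⟨⟨p, hp, rfl⟩, hvG⟩
    exact ⟨p, hp, (hF.extremePoint v hv p).resolve_left fun h => hvG ⟨hv.1, h⟩, rfl⟩
  · rintro ⟨p, hp, hvp, rfl⟩
    exact ⟨⟨p, hp, rfl⟩, fun h => by simp [hvp] at h⟩

lemma IsFacetOpposite.isZeroOneSlice (hF : IsZeroOneSlice F) (hG : IsFacetOpposite F v G) :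
    IsZeroOneSlice G :=
  hF.of_isFace hG.1.prop.1

lemma IsZeroOneSlice.finite_facetsOpposite (hF : IsZeroOneSlice F) (hv : v ∈ F.extremePoints ℝ) :
    {G | IsFacetOpposite F v G}.Finite := by
  obtain ⟨B, hB⟩ := hF.exists_isIrredundant
  refine (B.finite_toSet.image fun p => {x ∈ F | x p = 0}).subset fun G hG => ?_
  obtain ⟨p, hp, -, rfl⟩ := (hB.isFacetOpposite_iff hF hv).1 hG
  exact ⟨p, hp, rfl⟩

lemma IsZeroOneSlice.eq_of_span_eq (hF : IsZeroOneSlice F) (hG : IsZeroOneSlice G)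
    (h : affineSpan ℝ F = affineSpan ℝ G) : F = G := by
  ext x
  rw [hF.mem_iff, hG.mem_iff, h]

/-- The cones from a vertex over the opposite facets cover the polytope. -/
lemma IsZeroOneSlice.exists_facetOpposite (hF : IsZeroOneSlice F) (hv : v ∈ F.extremePoints ℝ)
    {x : EuclideanSpace ℝ ι} (hx : x ∈ F) (hxv : x ≠ v) :
    ∃ G, IsFacetOpposite F v G ∧ ∃ y ∈ G, x ∈ segment ℝ v y := by
  classical
  obtain ⟨B, hB⟩ := hF.exists_isIrredundant
  have hvF := (hB.mem_iff v).1 hv.1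
  have hxF := (hB.mem_iff x).1 hx
  have hval : ∀ t q, (v + t • (x - v)) q = v q + t * (x q - v q) := by simp
  -- The ray from `v` through `x` must leave the bounded set `F`.
  have hne : (B.filter fun p => x p < v p).Nonempty := by
    by_contra hempty
    rw [Finset.not_nonempty_iff_eq_empty, Finset.filter_eq_empty_iff] at hempty
    have hray : ∀ t : ℝ, 0 ≤ t → v + t • (x - v) ∈ F := by
      intro t ht
      refine (hB.mem_iff _).2 ⟨add_smul_sub_mem_span hvF.1 hxF.1 hvF.1 t, fun q hq => ?_⟩
      rw [hval]
      have h1 := not_lt.1 (hempty hq)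
      have := mul_nonneg ht (sub_nonneg.2 h1)
      linarith [hvF.2 q hq]
    obtain ⟨q, hq⟩ : ∃ q, x q ≠ v q := by
      by_contra! hcon
      exact hxv (by ext q; exact hcon q)
    obtain ⟨R, hR⟩ := hF.isCompact.isBounded.exists_norm_le
    have hd : 0 < |x q - v q| := abs_pos.2 (sub_ne_zero.2 hq)
    have hR0 : 0 ≤ R := (norm_nonneg _).trans (hR v hv.1)
    have hvq := (PiLp.norm_apply_le v q).trans (hR v hv.1)
    have h1 := (PiLp.norm_apply_le _ q).trans
      (hR _ (hray ((2 * R + 1) / |x q - v q|) (by positivity)))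
    rw [hval] at h1
    rw [Real.norm_eq_abs] at h1 hvq
    have h2 : |(2 * R + 1) / |x q - v q| * (x q - v q)| = 2 * R + 1 := by
      rw [abs_mul, abs_div, abs_abs, div_mul_cancel₀ _ hd.ne', abs_of_pos (by linarith)]
    have h3 := abs_sub_abs_le_abs_sub ((2 * R + 1) / |x q - v q| * (x q - v q)) (-(v q))
    rw [h2, abs_neg, sub_neg_eq_add, add_comm _ (v q)] at h3
    linarith
  -- The first inequality violated along the ray gives the facet.
  obtain ⟨p, hp, hmin⟩ := Finset.exists_min_image _ (fun p => v p / (v p - x p)) hne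
  obtain ⟨hpB, hpx⟩ := Finset.mem_filter.1 hp
  have hd : 0 < v p - x p := sub_pos.2 hpx
  have hxp := hxF.2 p hpB
  set t := v p / (v p - x p) with ht
  have ht1 : 1 ≤ t := by rw [ht, le_div_iff₀ hd]; linarith
  have hp0 : (v + t • (x - v)) p = 0 := by
    rw [hval, ht]; field_simp; ring
  have hmem : v + t • (x - v) ∈ F := by
    refine (hB.mem_iff _).2 ⟨add_smul_sub_mem_span hvF.1 hxF.1 hvF.1 t, fun q hq => ?_⟩
    rw [hval]
    by_cases hlt : x q < v q
    · have h1 := hmin q (Finset.mem_filter.2 ⟨hq, hlt⟩)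
      have hdq : 0 < v q - x q := sub_pos.2 hlt
      have h2 := (le_div_iff₀ hdq).1 h1
      linarith
    · have := mul_nonneg (zero_le_one.trans ht1) (sub_nonneg.2 (not_lt.1 hlt))
      linarith [hvF.2 q hq]
  refine ⟨{x ∈ F | x p = 0}, (hB.isFacetOpposite_iff hF hv).2 ⟨p, hpB, ?_, rfl⟩, _,
    ⟨hmem, hp0⟩, ?_⟩
  · exact (hF.extremePoint v hv p).resolve_left fun h => by linarith
  · have ht0 : 0 < t := by linarith
    refine ⟨1 - t⁻¹, t⁻¹, sub_nonneg.2 (inv_le_one_of_one_le₀ ht1), by positivity, by ring, ?_⟩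
    rw [smul_add, smul_smul, inv_mul_cancel₀ ht0.ne', one_smul, ← add_assoc, ← add_smul]
    simp

/-- Adding the opposite vertex to a unimodular simplex of a facet gives a unimodular simplex, since
that vertex has lattice height one. -/
lemma IsUnimodularSimplex.insert_vertex [DecidableEq (EuclideanSpace ℝ ι)]
    (hF : IsZeroOneSlice F) (hv : v ∈ F.extremePoints ℝ)
    (hG : IsFacetOpposite F v G) {s : Finset (EuclideanSpace ℝ ι)}
    (hs : IsUnimodularSimplex G s) : IsUnimodularSimplex F (insert v s) := by
  obtain ⟨B, hB⟩ := hF.exists_isIrredundant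
  have hGs := hG.isZeroOneSlice hF
  have hvG := hG.2
  obtain ⟨p, hp, hvp, rfl⟩ := (hB.isFacetOpposite_iff hF hv).1 hG
  have hsG := hs.subset
  have hvs : v ∉ s := fun h => hvG (hsG h)
  obtain ⟨w, hw⟩ : s.Nonempty := by
    rw [← Finset.coe_nonempty, ← affineSpan_nonempty ℝ, hs.span_eq, affineSpan_nonempty]
    exact hGs.nonempty
  have hwG := hsG hw
  have hvA := subset_affineSpan ℝ F hv.1
  have hwA := subset_affineSpan ℝ F hwG.1
  have hvspan : v ∉ affineSpan ℝ (s : Set (EuclideanSpace ℝ ι)) := by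
    intro h
    have := coord_eq_zero_of_mem_affineSpan (p := p) (fun y hy => (hsG hy).2) h
    linarith
  -- Subtracting a multiple of `v - w` from a point of the span moves it into the facet.
  have hred : ∀ x ∈ affineSpan ℝ F, x + (x p) • (w - v) ∈ affineSpan ℝ {y ∈ F | y p = 0} := by
    intro x hx
    refine hB.mem_affineSpan_facet hF hp (add_smul_sub_mem_span hx hwA hvA _) ?_
    simp [hwG.2, hvp]
  have hvint : ∀ q, ∃ k : ℤ, v q = k := by
    intro q
    rcases hF.extremePoint v hv q with h | h
    · exact ⟨0, by simp [h]⟩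
    · exact ⟨1, by simp [h]⟩
  refine ⟨?_, ?_, ?_, ?_, ?_⟩
  · rw [Finset.coe_insert]
    exact insert_subset hv.1 fun y hy => (hsG hy).1
  · intro y hy
    rcases Finset.mem_insert.1 hy with rfl | hy
    · exact hvint
    · exact hs.integral y hy
  · refine AffineIndependent.affineIndependent_of_notMem_span
      (i := (⟨v, Finset.mem_insert_self v s⟩ : (insert v s : Finset _))) ?_ ?_
    · let e : {y : (insert v s : Finset (EuclideanSpace ℝ ι)) //
          y ≠ ⟨v, Finset.mem_insert_self v s⟩} ↪ s :=
        ⟨fun y => ⟨y.1.1, (Finset.mem_insert.1 y.1.2).resolve_left fun h => y.2 (Subtype.ext h)⟩,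
          fun y z h => Subtype.ext (Subtype.ext
            (show y.1.1 = z.1.1 from congrArg (fun t : s => t.1) h))⟩
      exact hs.affineIndependent.comp_embedding e
    · refine fun h => hvspan (affineSpan_mono ℝ ?_ h)
      rintro _ ⟨y, hy, rfl⟩
      exact (Finset.mem_insert.1 y.2).resolve_left fun h => hy (Subtype.ext h)
  · apply le_antisymm
    · rw [affineSpan_le, Finset.coe_insert]
      exact insert_subset hvA fun y hy => subset_affineSpan ℝ F (hsG hy).1
    · intro x hx
      have h1 := hred x hx
      rw [← hs.span_eq] at h1
      have h2 := affineSpan_mono ℝ (show (s : Set (EuclideanSpace ℝ ι)) ⊆ ↑(insert v s) by simp) h1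
      have h3 := add_smul_sub_mem_span h2
        (subset_affineSpan ℝ _ (show v ∈ (↑(insert v s) : Set (EuclideanSpace ℝ ι)) by simp))
        (subset_affineSpan ℝ _ (show w ∈ (↑(insert v s) : Set (EuclideanSpace ℝ ι)) by simp [hw]))
        (x p)
      convert h3 using 1
      module
  · rintro z ⟨hz, hzint⟩
    obtain ⟨m, hm⟩ := hzint p
    obtain ⟨k, hk1, hk⟩ := hs.exists_int_comb (z + (z p) • (w - v)) ⟨hred z hz, fun q => by
      obtain ⟨a, ha⟩ := hzint q
      obtain ⟨b, hb⟩ := hvint q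
      obtain ⟨c, hc⟩ := hs.integral w hw q
      exact ⟨a + m * (c - b), by simp [ha, hb, hc, hm]⟩⟩
    refine ⟨fun y => if y = v then m else k y - if y = w then m else 0, ?_, ?_⟩
    · have hcongr : ∀ y ∈ s, (if y = v then m else k y - if y = w then m else 0)
          = k y - if y = w then m else 0 :=
        fun y hy => if_neg (ne_of_mem_of_not_mem hy hvs)
      rw [Finset.sum_insert hvs, Finset.sum_congr rfl hcongr, Finset.sum_sub_distrib, hk1]
      simp [hw]
    · have hcongr : ∀ y ∈ s, (((if y = v then m else k y - if y = w then m else 0 : ℤ) : ℝ)) • y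
          = (k y : ℝ) • y - if y = w then (m : ℝ) • y else 0 := by
        intro y hy
        rw [if_neg (ne_of_mem_of_not_mem hy hvs)]
        split_ifs <;> push_cast <;> module
      rw [Finset.sum_insert hvs, Finset.sum_congr rfl hcongr, Finset.sum_sub_distrib, hk,
        Finset.sum_ite_eq' s w, if_pos hw, hm]
      simp only [if_pos]
      module

/-- Two cones over opposite facets whose relatively open simplices meet have the same base. -/
lemma IsUnimodularSimplex.facet_eq_of_mem_openHull [DecidableEq (EuclideanSpace ℝ ι)]
    (hF : IsZeroOneSlice F) (hv : v ∈ F.extremePoints ℝ)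
    {G' : Set (EuclideanSpace ℝ ι)} (hG : IsFacetOpposite F v G) (hG' : IsFacetOpposite F v G')
    {s t : Finset (EuclideanSpace ℝ ι)} (hs : IsUnimodularSimplex G s)
    (ht : IsUnimodularSimplex G' t) {x : EuclideanSpace ℝ ι} (hxs : x ∈ openHull (insert v s))
    (hxt : x ∈ openHull (insert v t)) : G = G' ∧ ∃ y, y ∈ openHull s ∧ y ∈ openHull t := by
  obtain ⟨B, hB⟩ := hF.exists_isIrredundant
  have hGs := hG.isZeroOneSlice hF
  have hGs' := hG'.isZeroOneSlice hF
  have hvG := hG.2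
  have hvG' := hG'.2
  obtain ⟨p, hp, hvp, rfl⟩ := (hB.isFacetOpposite_iff hF hv).1 hG
  obtain ⟨p', hp', hvp', rfl⟩ := (hB.isFacetOpposite_iff hF hv).1 hG'
  have hsne : s.Nonempty := by
    rw [← Finset.coe_nonempty, ← affineSpan_nonempty ℝ, hs.span_eq, affineSpan_nonempty]
    exact hGs.nonempty
  have htne : t.Nonempty := by
    rw [← Finset.coe_nonempty, ← affineSpan_nonempty ℝ, ht.span_eq, affineSpan_nonempty]
    exact hGs'.nonempty
  obtain ⟨y, hy, c, hc, hxy⟩ :=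
    exists_of_mem_openHull_insert hsne (fun h => hvG (hs.subset h)) hxs
  obtain ⟨y', hy', c', hc', hxy'⟩ :=
    exists_of_mem_openHull_insert htne (fun h => hvG' (ht.subset h)) hxt
  have hyG := convexHull_min hs.subset hGs.convex (openHull_subset_convexHull s hy)
  have hyG' := convexHull_min ht.subset hGs'.convex (openHull_subset_convexHull t hy')
  -- Comparing the coordinates `p` and `p'` of `x` shows that both cones have the same height.
  have hcc : c = c' := by
    have e1 : (1 - c) * v p + c * y p = (1 - c') * v p + c' * y' p := by
      simpa using congrArg (fun z : EuclideanSpace ℝ ι => z p) (hxy.symm.trans hxy')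
    have e2 : (1 - c) * v p' + c * y p' = (1 - c') * v p' + c' * y' p' := by
      simpa using congrArg (fun z : EuclideanSpace ℝ ι => z p') (hxy.symm.trans hxy')
    rw [hvp, hyG.2] at e1
    rw [hvp', hyG'.2] at e2
    have h1 := mul_nonneg hc'.le (((hB.mem_iff _).1 hyG'.1).2 p hp)
    have h2 := mul_nonneg hc.le (((hB.mem_iff _).1 hyG.1).2 p' hp')
    linarith
  subst hcc
  have hyy : y = y' := by
    have h := hxy.symm.trans hxy'
    exact smul_right_injective _ hc.ne' (add_left_cancel h)
  subst hyy
  have hsp : ∀ z ∈ s, z p' = 0 := coord_eq_zero_of_mem_openHull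
    (fun z hz => ((hB.mem_iff z).1 (hs.subset hz).1).2 p' hp') hy hyG'.2
  have htp : ∀ z ∈ t, z p = 0 := coord_eq_zero_of_mem_openHull
    (fun z hz => ((hB.mem_iff z).1 (ht.subset hz).1).2 p hp) hy' hyG.2
  refine ⟨Subset.antisymm (fun z hz => ⟨hz.1, ?_⟩) (fun z hz => ⟨hz.1, ?_⟩), y, hy, hy'⟩
  · exact coord_eq_zero_of_mem_affineSpan hsp (hs.span_eq ▸ subset_affineSpan ℝ _ hz)
  · exact coord_eq_zero_of_mem_affineSpan htp (ht.span_eq ▸ subset_affineSpan ℝ _ hz)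

lemma IsUnimodularTriangulation.cone (hF : IsZeroOneSlice F) (hnt : F.Nontrivial)
    (hv : v ∈ F.extremePoints ℝ) {S : Set (EuclideanSpace ℝ ι) → Set (Set (EuclideanSpace ℝ ι))}
    (hS : ∀ G, IsFacetOpposite F v G → IsUnimodularTriangulation G (S G)) :
    IsUnimodularTriangulation F
      {s | ∃ G, IsFacetOpposite F v G ∧ ∃ t ∈ S G, s = insert v t} where
  finite := by
    refine ((hF.finite_facetsOpposite hv).biUnion
      fun G hG => (hS G hG).finite.image (insert v)).subset ?_
    rintro s ⟨G, hG, t, ht, rfl⟩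
    exact mem_biUnion hG ⟨t, ht, rfl⟩
  exists_simplex := by
    classical
    rintro s ⟨G, hG, t, ht, rfl⟩
    obtain ⟨t, rfl, h⟩ := (hS G hG).exists_simplex t ht
    exact ⟨insert v t, by simp, h.insert_vertex hF hv hG⟩
  cover := by
    have key : ∀ x ∈ F, x ≠ v → ∃ s ∈ {s | ∃ G, IsFacetOpposite F v G ∧ ∃ t ∈ S G, s = insert v t},
        x ∈ convexHull ℝ s := by
      intro x hx hxv
      obtain ⟨G, hG, y, hy, hxy⟩ := hF.exists_facetOpposite hv hx hxv
      obtain ⟨t, ht, hyt⟩ := (hS G hG).cover y hy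
      exact ⟨insert v t, ⟨G, hG, t, ht, rfl⟩,
        (convex_convexHull ℝ _).segment_subset (subset_convexHull ℝ _ (mem_insert v t))
          (convexHull_mono (subset_insert v t) hyt) hxy⟩
    intro x hx
    by_cases hxv : x = v
    · obtain ⟨z, hz, hzv⟩ := hnt.exists_ne v
      obtain ⟨s, ⟨G, hG, t, ht, rfl⟩, -⟩ := key z hz hzv
      exact ⟨insert v t, ⟨G, hG, t, ht, rfl⟩, subset_convexHull ℝ _ (by simp [hxv])⟩
    · exact key x hx hxv
  eq_of_mem_openHull := by
    classical
    rintro s s' ⟨G, hG, t, ht, hs⟩ ⟨G', hG', t', ht', hs'⟩ x hx hx'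
    obtain ⟨t, rfl, h⟩ := (hS G hG).exists_simplex t ht
    obtain ⟨t', rfl, h'⟩ := (hS G' hG').exists_simplex t' ht'
    rw [← Finset.coe_insert, Finset.coe_inj] at hs hs'
    subst hs hs'
    obtain ⟨rfl, y, hy, hy'⟩ := h.facet_eq_of_mem_openHull hF hv hG hG' h' hx hx'
    rw [(hS G hG).eq_of_mem_openHull t t' ht ht' y hy hy']

/-- By induction along the recursive construction, every standard triangulation is unimodular. -/
theorem IsStandardTriangulation.isUnimodularTriangulation
    {T : Set (Set (EuclideanSpace ℝ ι))} (hT : IsStandardTriangulation F T)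
    (hF : IsZeroOneSlice F) : IsUnimodularTriangulation F T := by
  induction hT with
  | point v =>
    refine isUnimodularTriangulation_singleton fun p => ?_
    rcases hF.extremePoint v (by simp) p with h | h
    · exact ⟨0, by simp [h]⟩
    · exact ⟨1, by simp [h]⟩
  | cone P hP v hv S hS ih =>
    exact .cone hF hP hv fun G hG => ih G hG (hG.isZeroOneSlice hF)

lemma IsFacetOpposite.dim_lt (hF : IsZeroOneSlice F) (hG : IsFacetOpposite F v G) :
    dim G < dim F := by
  have hGs := hG.isZeroOneSlice hF
  have hsub := hG.1.prop.1.2.subset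
  refine Submodule.finrank_lt_finrank_of_lt (lt_of_le_of_ne (vectorSpan_mono ℝ hsub) fun h => ?_)
  rw [← direction_affineSpan, ← direction_affineSpan] at h
  obtain ⟨x, hx⟩ := hGs.nonempty
  exact hG.1.prop.2 (hGs.eq_of_span_eq hF (AffineSubspace.ext_of_direction_eq h
    ⟨x, subset_affineSpan ℝ _ hx, subset_affineSpan ℝ _ (hsub hx)⟩))

theorem IsZeroOneSlice.exists_isStandardTriangulation (hF : IsZeroOneSlice F) :
    ∃ T, IsStandardTriangulation F T := by
  induction hd : dim F using Nat.strong_induction_on generalizing F with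
  | _ d ih =>
    subst hd
    obtain ⟨v, hv⟩ := hF.isCompact.extremePoints_nonempty hF.nonempty
    rcases F.subsingleton_or_nontrivial with hss | hnt
    · rw [hss.eq_singleton_of_mem hv.1]
      exact ⟨_, .point v⟩
    · classical
      have hex : ∀ G, ∃ T, IsFacetOpposite F v G → IsStandardTriangulation G T := by
        intro G
        by_cases hG : IsFacetOpposite F v G
        · obtain ⟨T, hT⟩ := ih _ (hG.dim_lt hF) (hG.isZeroOneSlice hF) rfl
          exact ⟨T, fun _ => hT⟩
        · exact ⟨∅, fun h => absurd h hG⟩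
      choose S hS using hex
      exact ⟨_, .cone F hnt v hv S hS⟩

/-- The simplices of a cone triangulation correspond to those of the opposite facets. -/
lemma ncard_cone (hF : IsZeroOneSlice F) (hv : v ∈ F.extremePoints ℝ)
    {S : Set (EuclideanSpace ℝ ι) → Set (Set (EuclideanSpace ℝ ι))}
    (hS : ∀ G, IsFacetOpposite F v G → IsUnimodularTriangulation G (S G)) :
    ({s | ∃ G, IsFacetOpposite F v G ∧ ∃ t ∈ S G, s = insert v t}.ncard : ENNReal) =
      ∑' G : {G // IsFacetOpposite F v G}, ((S G.1).ncard : ENNReal) := by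
  have : Finite {G // IsFacetOpposite F v G} := (hF.finite_facetsOpposite hv).to_subtype
  let := Fintype.ofFinite {G // IsFacetOpposite F v G}
  have : ∀ G : {G // IsFacetOpposite F v G}, Finite (S G.1) :=
    fun G => (hS G.1 G.2).finite.to_subtype
  have hnot : ∀ G, IsFacetOpposite F v G → ∀ t ∈ S G, v ∉ t := by
    intro G hG t ht hvt
    obtain ⟨t, rfl, h⟩ := (hS G hG).exists_simplex t ht
    exact hG.2 (h.subset hvt)
  let f : (Σ G : {G // IsFacetOpposite F v G}, S G.1) →
      {s | ∃ G, IsFacetOpposite F v G ∧ ∃ t ∈ S G, s = insert v t} :=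
    fun x => ⟨insert v x.2.1, x.1.1, x.1.2, x.2.1, x.2.2, rfl⟩
  have hf : Function.Bijective f := by
    constructor
    · rintro ⟨⟨G, hG⟩, t, ht⟩ ⟨⟨G', hG'⟩, t', ht'⟩ h
      have htt : t = t' := eq_of_insert_eq_insert (hnot G hG t ht) (hnot G' hG' t' ht')
        (congrArg Subtype.val h)
      subst htt
      obtain ⟨s, rfl, hs⟩ := (hS G hG).exists_simplex t ht
      obtain ⟨s', hss, hs'⟩ := (hS G' hG').exists_simplex _ ht'
      obtain rfl := Finset.coe_injective hss
      -- A facet is recovered from the affine span of any of its full-dimensional simplices.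
      obtain rfl := (hG.isZeroOneSlice hF).eq_of_span_eq (hG'.isZeroOneSlice hF)
        (hs.span_eq.symm.trans hs'.span_eq)
      rfl
    · rintro ⟨s, G, hG, t, ht, rfl⟩
      exact ⟨⟨⟨G, hG⟩, t, ht⟩, rfl⟩
  rw [← Nat.card_coe_set_eq, ← Nat.card_congr (Equiv.ofBijective f hf), Nat.card_sigma,
    tsum_fintype]
  simp [Nat.card_coe_set_eq]

end Triangulations

/-! ### Volumes -/

section SimplexVolume

variable {V : Type*} [NormedAddCommGroup V] [NormedSpace ℝ V]

lemma linearIndependent_succ_sub {d : ℕ} {w : Fin (d + 1) → V} (hw : AffineIndependent ℝ w) :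
    LinearIndependent ℝ fun i : Fin d => w i.succ - w 0 := by
  rw [affineIndependent_iff_linearIndependent_vsub ℝ w 0] at hw
  exact hw.comp (fun i : Fin d => (⟨i.succ, Fin.succ_ne_zero i⟩ : {x : Fin (d + 1) // x ≠ 0}))
    fun i j h => Fin.succ_injective _ (congrArg Subtype.val h)

variable [FiniteDimensional ℝ V] [MeasurableSpace V]
  (μ : Measure V) [μ.IsAddHaarMeasure]

lemma measure_simplex_ne_zero {d : ℕ} (hd : Module.finrank ℝ V = d) {w : Fin (d + 1) → V}
    (hw : AffineIndependent ℝ w) : μ (convexHull ℝ (range w)) ≠ 0 := by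
  have h := (hw.affineSpan_eq_top_iff_card_eq_finrank_add_one).2 (by simp [hd])
  have := interior_convexHull_nonempty_iff_affineSpan_eq_top.2 h
  exact (Measure.measure_pos_of_nonempty_interior μ this).ne'

variable [BorelSpace V]

/-- A simplex whose vertices are integer affine combinations of the vertices of another simplex is at
least as large as that simplex: the ratio of the volumes is a nonzero integer determinant. -/
lemma measure_simplex_le {d : ℕ} (hd : Module.finrank ℝ V = d) {w w' : Fin (d + 1) → V}
    (hw : AffineIndependent ℝ w) (hw' : AffineIndependent ℝ w') (K : Fin (d + 1) → Fin (d + 1) → ℤ)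
    (hK1 : ∀ j, ∑ i, K j i = 1) (hK : ∀ j, ∑ i, (K j i : ℝ) • w i = w' j) :
    μ (convexHull ℝ (range w)) ≤ μ (convexHull ℝ (range w')) := by
  let b := Module.Basis.mk (linearIndependent_succ_sub hw)
    ((linearIndependent_succ_sub hw).span_eq_top_of_card_eq_finrank' (by simp [hd])).ge
  let b' := Module.Basis.mk (linearIndependent_succ_sub hw')
    ((linearIndependent_succ_sub hw').span_eq_top_of_card_eq_finrank' (by simp [hd])).ge
  have hb : ∀ i, b i = w i.succ - w 0 := fun i => by simp [b]
  have hb' : ∀ i, b' i = w' i.succ - w' 0 := fun i => by simp [b']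
  let M : V ≃ₗ[ℝ] V := b.equiv b' (Equiv.refl _)
  have hM : ∀ i : Fin d, M (w i.succ - w 0) = w' i.succ - w' 0 := by
    intro i
    rw [← hb, ← hb']
    simp [M]
  let A : Matrix (Fin d) (Fin d) ℤ := fun i j => K j.succ i.succ - K 0 i.succ
  have hMA : LinearMap.toMatrix b b (M : V →ₗ[ℝ] V) = A.map (Int.castRingHom ℝ) := by
    ext i j
    have hsum : (M : V →ₗ[ℝ] V) (b j) = ∑ i, (A i j : ℝ) • b i := by
      have h1 : ∀ j, w' j = w 0 + ∑ i : Fin d, (K j i.succ : ℝ) • b i := by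
        intro j
        have h2 : (K j 0 : ℝ) = 1 - ∑ i : Fin d, (K j i.succ : ℝ) := by
          have := hK1 j
          rw [Fin.sum_univ_succ] at this
          rw [eq_sub_iff_add_eq]
          exact_mod_cast this
        rw [← hK j, Fin.sum_univ_succ, h2]
        simp only [hb, smul_sub, Finset.sum_sub_distrib, ← Finset.sum_smul]
        module
      rw [LinearEquiv.coe_coe, hb, hM, h1 j.succ, h1 0, add_sub_add_left_eq_sub,
        ← Finset.sum_sub_distrib]
      refine Finset.sum_congr rfl fun i _ => ?_
      simp only [A]
      push_cast
      module
    rw [LinearMap.toMatrix_apply, hsum, b.repr_sum_self]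
    rfl
  have hdet : LinearMap.det (M : V →ₗ[ℝ] V) = (A.det : ℝ) := by
    rw [← LinearMap.det_toMatrix b, hMA, ← RingHom.mapMatrix_apply, ← RingHom.map_det]
    rfl
  have hdet1 : 1 ≤ |LinearMap.det (M : V →ₗ[ℝ] V)| := by
    have h0 : LinearMap.det (M : V →ₗ[ℝ] V) ≠ 0 := (LinearEquiv.isUnit_det' M).ne_zero
    rw [hdet] at h0 ⊢
    exact_mod_cast Int.one_le_abs (by exact_mod_cast h0)
  let f : V →ᵃ[ℝ] V := (M : V →ₗ[ℝ] V).toAffineMap + AffineMap.const ℝ V (w' 0 - M (w 0))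
  have hf : ∀ x, f x = M x + (w' 0 - M (w 0)) := fun x => rfl
  have hfw : f ∘ w = w' := by
    funext i
    rw [Function.comp_apply, hf]
    induction i using Fin.cases with
    | zero => abel
    | succ i =>
      have := hM i
      rw [map_sub] at this
      rw [eq_add_of_sub_eq this]
      abel
  have himg : convexHull ℝ (range w') =
      (fun x => x + (w' 0 - M (w 0))) '' ((M : V →ₗ[ℝ] V) '' convexHull ℝ (range w)) := by
    have h : convexHull ℝ (range w') = f '' convexHull ℝ (range w) := by
      rw [AffineMap.image_convexHull, ← range_comp, hfw]
    rw [h, image_image]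
    rfl
  rw [himg, image_add_right, measure_preimage_add_right, Measure.addHaar_image_linearMap]
  calc μ (convexHull ℝ (range w)) = ENNReal.ofReal 1 * μ (convexHull ℝ (range w)) := by simp
    _ ≤ _ := by gcongr

end SimplexVolume

section RelativeVolume

variable {ι : Type*} [Fintype ι] {F : Set (EuclideanSpace ℝ ι)}

/-- An isometric affine parametrization of the affine span of `F`. -/
lemma exists_chart (hF : F.Nonempty) :
    ∃ ψ : EuclideanSpace ℝ (Fin (dim F)) →ᵃⁱ[ℝ] EuclideanSpace ℝ ι,
      range ψ = (affineSpan ℝ F : Set (EuclideanSpace ℝ ι)) := by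
  obtain ⟨p, hp⟩ := hF
  let L : EuclideanSpace ℝ (Fin (dim F)) →ₗᵢ[ℝ] EuclideanSpace ℝ ι :=
    (vectorSpan ℝ F).subtypeₗᵢ.comp
      (stdOrthonormalBasis ℝ (vectorSpan ℝ F)).repr.symm.toLinearIsometry
  refine ⟨(AffineIsometryEquiv.vaddConst ℝ p).toAffineIsometry.comp L.toAffineIsometry, ?_⟩
  have hpA := subset_affineSpan ℝ F hp
  ext x
  constructor
  · rintro ⟨y, rfl⟩
    have h : L y ∈ (affineSpan ℝ F).direction := by
      rw [direction_affineSpan]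
      exact Submodule.coe_mem _
    exact AffineSubspace.vadd_mem_of_mem_direction h hpA
  · intro hx
    have h : x -ᵥ p ∈ vectorSpan ℝ F := by
      rw [← direction_affineSpan]
      exact AffineSubspace.vsub_mem_direction hx hpA
    refine ⟨(stdOrthonormalBasis ℝ (vectorSpan ℝ F)).repr ⟨x -ᵥ p, h⟩, ?_⟩
    change (((stdOrthonormalBasis ℝ (vectorSpan ℝ F)).repr.symm
      ((stdOrthonormalBasis ℝ (vectorSpan ℝ F)).repr ⟨x -ᵥ p, h⟩) : vectorSpan ℝ F) :
      EuclideanSpace ℝ ι) + p = x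
    rw [LinearIsometryEquiv.symm_apply_apply]
    simp

lemma euclideanHausdorffMeasure_image_chart {d : ℕ}
    (ψ : EuclideanSpace ℝ (Fin d) →ᵃⁱ[ℝ] EuclideanSpace ℝ ι) (S : Set (EuclideanSpace ℝ (Fin d))) :
    Measure.euclideanHausdorffMeasure d (ψ '' S) = volume S := by
  rw [ψ.isometry.euclideanHausdorffMeasure_image, EuclideanSpace.euclideanHausdorffMeasure_eq_volume]

lemma convexHull_range_chart {d : ℕ} (ψ : EuclideanSpace ℝ (Fin d) →ᵃⁱ[ℝ] EuclideanSpace ℝ ι)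
    {κ : Type*} (w : κ → EuclideanSpace ℝ (Fin d)) :
    convexHull ℝ (range (ψ ∘ w)) = ψ '' convexHull ℝ (range w) := by
  rw [range_comp]
  exact (AffineMap.image_convexHull ψ.toAffineMap _).symm

/-- Sets contained in a proper affine subspace of the affine span of `F` are null. -/
lemma euclideanHausdorffMeasure_affineSubspace (hF : F.Nonempty)
    {A : AffineSubspace ℝ (EuclideanSpace ℝ ι)} (hA : A < affineSpan ℝ F) :
    Measure.euclideanHausdorffMeasure (dim F) (A : Set (EuclideanSpace ℝ ι)) = 0 := by
  obtain ⟨ψ, hψ⟩ := exists_chart hF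
  have himg : (A : Set (EuclideanSpace ℝ ι)) = ψ '' (A.comap ψ.toAffineMap : Set _) := by
    have : (A : Set (EuclideanSpace ℝ ι)) ⊆ range ψ := hψ ▸ hA.le
    exact (image_preimage_eq_of_subset this).symm
  rw [himg, euclideanHausdorffMeasure_image_chart]
  refine Measure.addHaar_affineSubspace _ _ fun htop => hA.not_ge fun x hx => ?_
  have hx' : x ∈ range ψ := by rw [hψ]; exact hx
  obtain ⟨y, rfl⟩ := hx'
  have hy : y ∈ A.comap ψ.toAffineMap := htop ▸ AffineSubspace.mem_top ℝ _ y
  exact hy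

lemma IsUnimodularSimplex.exists_fin {s : Finset (EuclideanSpace ℝ ι)}
    (hF : F.Nonempty) (hs : IsUnimodularSimplex F s) :
    ∃ w : Fin (dim F + 1) → EuclideanSpace ℝ ι, AffineIndependent ℝ w ∧
      range w = (s : Set (EuclideanSpace ℝ ι)) := by
  have hne : s.Nonempty := by
    rw [← Finset.coe_nonempty, ← affineSpan_nonempty ℝ, hs.span_eq, affineSpan_nonempty]
    exact hF
  have hcard : s.card = dim F + 1 := by
    obtain ⟨m, hm⟩ := Nat.exists_eq_add_one_of_ne_zero hne.card_ne_zero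
    have h := hs.affineIndependent.finrank_vectorSpan (n := m) (by simpa using hm)
    rw [Subtype.range_coe_subtype, ← direction_affineSpan] at h
    change Module.finrank ℝ (affineSpan ℝ (s : Set (EuclideanSpace ℝ ι))).direction = m at h
    rw [hs.span_eq, direction_affineSpan] at h
    rw [hm, dim, h]
  let e := (s.equivFinOfCardEq hcard).symm
  refine ⟨fun i => e i, hs.affineIndependent.comp_embedding e.toEmbedding, ?_⟩
  ext x
  constructor
  · rintro ⟨i, rfl⟩
    exact (e i).2
  · intro hx
    exact ⟨e.symm ⟨x, hx⟩, by simp⟩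

lemma exists_chart_lift {d : ℕ} {ψ : EuclideanSpace ℝ (Fin d) →ᵃⁱ[ℝ] EuclideanSpace ℝ ι}
    (hψ : range ψ = (affineSpan ℝ F : Set (EuclideanSpace ℝ ι)))
    {κ : Type*} {w : κ → EuclideanSpace ℝ ι} (hw : AffineIndependent ℝ w)
    (hmem : ∀ i, w i ∈ affineSpan ℝ F) :
    ∃ u : κ → EuclideanSpace ℝ (Fin d), ψ ∘ u = w ∧ AffineIndependent ℝ u := by
  have hex : ∀ i, ∃ u, ψ u = w i := fun i => by
    have : w i ∈ range ψ := by rw [hψ]; exact hmem i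
    exact this
  choose u hu using hex
  have huw : ψ ∘ u = w := funext hu
  refine ⟨u, huw, AffineIndependent.of_comp ψ.toAffineMap ?_⟩
  change AffineIndependent ℝ (ψ ∘ u)
  rwa [huw]

lemma chart_sum {d : ℕ} (ψ : EuclideanSpace ℝ (Fin d) →ᵃⁱ[ℝ] EuclideanSpace ℝ ι)
    {κ : Type*} [Fintype κ] (a : κ → ℝ) (ha : ∑ i, a i = 1) (u : κ → EuclideanSpace ℝ (Fin d)) :
    ψ (∑ i, a i • u i) = ∑ i, a i • ψ (u i) := by
  have hlin : ∀ x, ψ x = ψ.linear x + ψ 0 := fun x => congrFun (AffineMap.decomp ψ.toAffineMap) x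
  simp only [hlin (∑ i, a i • u i), map_sum, map_smul, hlin (u _), smul_add,
    Finset.sum_add_distrib, ← Finset.sum_smul, ha, one_smul]

lemma sum_comp_of_range_eq {κ α N : Type*} [Fintype κ] [AddCommMonoid N] {w : κ → α}
    (hw : Function.Injective w) {s : Finset α} (h : range w = s) (g : α → N) :
    ∑ i, g (w i) = ∑ y ∈ s, g y := by
  classical
  have himg : s = Finset.univ.image w := Finset.coe_injective (by simp [← h])
  rw [himg, Finset.sum_image fun i _ j _ h => hw h]

/-- Unimodular simplices have the minimal volume among the simplices with vertices in the lattice. -/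
lemma IsUnimodularSimplex.measure_eq {s : Finset (EuclideanSpace ℝ ι)}
    (hF : F.Nonempty) (hs : IsUnimodularSimplex F s) :
    Measure.euclideanHausdorffMeasure (dim F) (convexHull ℝ (s : Set (EuclideanSpace ℝ ι)))
      = minSimplexVolume F := by
  obtain ⟨w, hw, hws⟩ := hs.exists_fin hF
  have hwmem : ∀ i, w i ∈ s := fun i => by
    have : w i ∈ (s : Set (EuclideanSpace ℝ ι)) := hws ▸ mem_range_self i
    exact this
  have hwA : ∀ i, w i ∈ affineSpan ℝ F := fun i => subset_affineSpan ℝ _ (hs.subset (hwmem i))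
  apply le_antisymm
  · refine le_sInf ?_
    rintro _ ⟨w', hw'L, hw', rfl⟩
    obtain ⟨ψ, hψ⟩ := exists_chart hF
    obtain ⟨u, rfl, hu⟩ := exists_chart_lift hψ hw hwA
    obtain ⟨u', rfl, hu'⟩ := exists_chart_lift hψ hw' fun i => (hw'L i).1
    rw [← hws, convexHull_range_chart, convexHull_range_chart,
      euclideanHausdorffMeasure_image_chart, euclideanHausdorffMeasure_image_chart]
    choose K hK1 hK using fun j => hs.exists_int_comb _ (hw'L j)
    have hKu : ∀ j, ∑ i, K j ((ψ ∘ u) i) = 1 := fun j => by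
      rw [sum_comp_of_range_eq hw.injective hws (K j), hK1]
    refine measure_simplex_le volume (by simp) hu hu' (fun j i => K j ((ψ ∘ u) i)) hKu fun j => ?_
    apply ψ.injective
    rw [chart_sum ψ _ (by exact_mod_cast hKu j)]
    exact (sum_comp_of_range_eq hw.injective hws fun y => (K j y : ℝ) • y).trans (hK j)
  · exact sInf_le ⟨w, fun i => ⟨hwA i, hs.integral _ (hwmem i)⟩, hw, by rw [hws]⟩

lemma IsUnimodularSimplex.minSimplexVolume_ne_zero {s : Finset (EuclideanSpace ℝ ι)}
    (hF : F.Nonempty) (hs : IsUnimodularSimplex F s) :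
    minSimplexVolume F ≠ 0 ∧ minSimplexVolume F ≠ ⊤ := by
  rw [← hs.measure_eq hF]
  obtain ⟨w, hw, hws⟩ := hs.exists_fin hF
  obtain ⟨ψ, hψ⟩ := exists_chart hF
  obtain ⟨u, rfl, hu⟩ := exists_chart_lift hψ hw fun i =>
    subset_affineSpan ℝ _ (hs.subset (hws ▸ mem_range_self i))
  rw [← hws, convexHull_range_chart, euclideanHausdorffMeasure_image_chart]
  exact ⟨measure_simplex_ne_zero volume (by simp) hu,
    (Set.Finite.isCompact_convexHull (𝕜 := ℝ) (finite_range u)).measure_ne_top⟩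

/-- A point of a simplex outside its relative interior lies in the span of a proper face. -/
lemma exists_mem_affineSpan_of_notMem_openHull [DecidableEq (EuclideanSpace ℝ ι)]
    {s : Finset (EuclideanSpace ℝ ι)} {x : EuclideanSpace ℝ ι}
    (hx : x ∈ convexHull ℝ (s : Set (EuclideanSpace ℝ ι))) (hx' : x ∉ openHull s) :
    ∃ y ∈ s, x ∈ affineSpan ℝ ((s.erase y : Finset _) : Set (EuclideanSpace ℝ ι)) := by
  obtain ⟨a, ha, h1, rfl⟩ := Finset.mem_convexHull'.1 hx
  have : ∃ y ∈ s, a y ≤ 0 := by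
    by_contra! hcon
    exact hx' ⟨a, hcon, h1, rfl⟩
  obtain ⟨y, hy, hay⟩ := this
  have hay0 : a y = 0 := le_antisymm hay (ha y hy)
  refine ⟨y, hy, convexHull_subset_affineSpan _ (Finset.mem_convexHull'.2
    ⟨a, fun z hz => ha z (Finset.mem_of_mem_erase hz), ?_, ?_⟩)⟩
  · rw [Finset.sum_erase _ hay0, h1]
  · rw [Finset.sum_erase _ (by rw [hay0, zero_smul])]

lemma IsUnimodularSimplex.measure_affineSpan_erase [DecidableEq (EuclideanSpace ℝ ι)]
    {s : Finset (EuclideanSpace ℝ ι)} (hF : F.Nonempty) (hs : IsUnimodularSimplex F s)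
    {y : EuclideanSpace ℝ ι} (hy : y ∈ s) :
    Measure.euclideanHausdorffMeasure (dim F)
      (affineSpan ℝ ((s.erase y : Finset _) : Set (EuclideanSpace ℝ ι)) :
        Set (EuclideanSpace ℝ ι)) = 0 := by
  refine euclideanHausdorffMeasure_affineSubspace hF (lt_of_le_of_ne ?_ fun h => ?_)
  · rw [← hs.span_eq]
    exact affineSpan_mono ℝ (by simp)
  · have hymem : y ∈ affineSpan ℝ ((s.erase y : Finset _) : Set (EuclideanSpace ℝ ι)) := by
      rw [h]
      exact subset_affineSpan ℝ _ (hs.subset hy)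
    refine hs.affineIndependent.notMem_affineSpan_sdiff ⟨y, hy⟩ univ (affineSpan_mono ℝ ?_ hymem)
    intro z hz
    obtain ⟨hzy, hz⟩ := Finset.mem_erase.1 hz
    exact ⟨⟨z, hz⟩, ⟨mem_univ _, fun h => hzy (congrArg Subtype.val h)⟩, rfl⟩

lemma IsUnimodularSimplex.measure_convexHull_diff_openHull {s : Finset (EuclideanSpace ℝ ι)}
    (hF : F.Nonempty) (hs : IsUnimodularSimplex F s) :
    Measure.euclideanHausdorffMeasure (dim F)
      (convexHull ℝ (s : Set (EuclideanSpace ℝ ι)) \ openHull s) = 0 := by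
  classical
  refine measure_mono_null (fun x hx => ?_) ((measure_biUnion_null_iff s.countable_toSet).2
    fun y hy => hs.measure_affineSpan_erase hF hy)
  obtain ⟨y, hy, h⟩ := exists_mem_affineSpan_of_notMem_openHull hx.1 hx.2
  exact mem_iUnion₂.2 ⟨y, hy, h⟩

/-- The relative volume counts the simplices of any unimodular triangulation. -/
theorem IsUnimodularTriangulation.ncard_eq_relativeVolume (hF : IsZeroOneSlice F)
    {T : Set (Set (EuclideanSpace ℝ ι))} (hT : IsUnimodularTriangulation F T) :
    (T.ncard : ENNReal) = relativeVolume F := by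
  classical
  obtain ⟨x, hx⟩ := hF.nonempty
  obtain ⟨s₀, hs₀, -⟩ := hT.cover x hx
  obtain ⟨t₀, -, ht₀⟩ := hT.exists_simplex s₀ hs₀
  obtain ⟨hm0, hmtop⟩ := ht₀.minSimplexVolume_ne_zero hF.nonempty
  let μ : Measure (EuclideanSpace ℝ ι) := Measure.euclideanHausdorffMeasure (dim F)
  have hunion : F = ⋃ s ∈ hT.finite.toFinset, convexHull ℝ s := by
    ext x
    simp only [mem_iUnion, Set.Finite.mem_toFinset, exists_prop]
    refine ⟨hT.cover x, ?_⟩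
    rintro ⟨s, hs, hxs⟩
    obtain ⟨t, rfl, ht⟩ := hT.exists_simplex s hs
    exact convexHull_min ht.subset hF.convex hxs
  have hvol : μ F = T.ncard * minSimplexVolume F := by
    have hsum : ∀ s ∈ hT.finite.toFinset, μ (convexHull ℝ s) = minSimplexVolume F := by
      intro s hs
      obtain ⟨t, rfl, ht⟩ := hT.exists_simplex s (hT.finite.mem_toFinset.1 hs)
      exact ht.measure_eq hF.nonempty
    have hmeas : ∀ s ∈ hT.finite.toFinset, NullMeasurableSet (convexHull ℝ s) μ := by
      intro s hs
      obtain ⟨t, rfl, ht⟩ := hT.exists_simplex s (hT.finite.mem_toFinset.1 hs)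
      exact (Set.Finite.isCompact_convexHull (𝕜 := ℝ) t.finite_toSet).measurableSet.nullMeasurableSet
    have hdisj : Set.Pairwise (hT.finite.toFinset : Set (Set (EuclideanSpace ℝ ι)))
        (Function.onFun (AEDisjoint μ) fun s => convexHull ℝ s) := by
      intro s hs t ht hst
      rw [Finset.mem_coe, Set.Finite.mem_toFinset] at hs ht
      obtain ⟨s, rfl, hs'⟩ := hT.exists_simplex s hs
      obtain ⟨t, rfl, ht'⟩ := hT.exists_simplex t ht
      -- A common point is not interior to both simplices, so it lies on the boundary of one.
      refine measure_mono_null ?_ (measure_union_null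
        (hs'.measure_convexHull_diff_openHull hF.nonempty)
        (ht'.measure_convexHull_diff_openHull hF.nonempty))
      rintro x ⟨hxs, hxt⟩
      by_cases h1 : x ∈ openHull s
      · refine Or.inr ⟨hxt, fun h2 => hst ?_⟩
        rw [hT.eq_of_mem_openHull s t hs ht x h1 h2]
      · exact Or.inl ⟨hxs, h1⟩
    conv_lhs => rw [hunion]
    rw [measure_biUnion_finset₀ hdisj hmeas, Finset.sum_congr rfl hsum, Finset.sum_const,
      nsmul_eq_mul, ncard_eq_toFinset_card T hT.finite]
  change _ = μ F / minSimplexVolume F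
  rw [hvol, ENNReal.mul_div_cancel_right hm0 hmtop]

/-- The relative volume is additive over the facets opposite a vertex, because a cone triangulation
has as many simplices as the triangulations of those facets together. -/
theorem IsZeroOneSlice.relativeVolume_eq_tsum (hF : IsZeroOneSlice F) (hd : 1 ≤ dim F)
    {v : EuclideanSpace ℝ ι} (hv : v ∈ F.extremePoints ℝ) :
    relativeVolume F = ∑' G : {G // IsFacetOpposite F v G}, relativeVolume G.1 := by
  have hnt : F.Nontrivial := by
    rw [← not_subsingleton_iff]
    intro h
    have := vectorSpan_of_subsingleton ℝ h
    rw [dim, this, finrank_bot] at hd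
    omega
  have hex : ∀ G, ∃ T, IsFacetOpposite F v G → IsUnimodularTriangulation G T := by
    intro G
    by_cases hG : IsFacetOpposite F v G
    · obtain ⟨T, hT⟩ := (hG.isZeroOneSlice hF).exists_isStandardTriangulation
      exact ⟨T, fun _ => hT.isUnimodularTriangulation (hG.isZeroOneSlice hF)⟩
    · exact ⟨∅, fun h => absurd h hG⟩
  choose S hS using hex
  rw [← (IsUnimodularTriangulation.cone hF hnt hv hS).ncard_eq_relativeVolume hF,
    ncard_cone hF hv hS]
  exact tsum_congr fun G => (hS G.1 G.2).ncard_eq_relativeVolume (G.2.isZeroOneSlice hF)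

end RelativeVolume

end Birkhoff

theorem mainTheorem2 (n : ℕ) (F : Set (EuclideanSpace ℝ (Fin n × Fin n)))
    (hF : Birkhoff.IsFace (Birkhoff.birkhoff n) F) :
    (∀ T : Set (Set (EuclideanSpace ℝ (Fin n × Fin n))),
      Birkhoff.IsStandardTriangulation F T →
        T.Finite ∧ (T.ncard : ENNReal) = Birkhoff.relativeVolume F) ∧
    (1 ≤ Birkhoff.dim F → ∀ v ∈ F.extremePoints ℝ,
      Birkhoff.relativeVolume F =
        ∑' G : {G : Set (EuclideanSpace ℝ (Fin n × Fin n)) // Birkhoff.IsFacetOpposite F v G},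
          Birkhoff.relativeVolume G.1) := by
  have hs := Birkhoff.isZeroOneSlice_of_isFace_birkhoff n hF
  refine ⟨fun T hT => ?_, fun hd v hv => hs.relativeVolume_eq_tsum hd hv⟩
  have hU := hT.isUnimodularTriangulation hs
  exact ⟨hU.finite, hU.ncard_eq_relativeVolume hs⟩
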